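/- Conventions. A (finitary) polynomial monad $T$ over a set $I$ is given by a polynomial $P=(I\xleftarrow{s}E\xrightarrow{p}B\xrightarrow{t}I)$ in sets, all fibres of $p$ being finite, together with a monad structure on the polynomial functor $\underline P:\mathrm{Set}/I\to\mathrm{Set}/I$, $\underline P(X)_i=\coprod_{b\in t^{-1}(i)}\prod_{e\in p^{-1}(b)}X_{s(e)}$, whose unit and multiplication are cartesian natural transformations. The elements $b\in B$ are the operations of $T$, the elements of $p^{-1}(b)$ are the inputs of $b$; $1_i$ denotes the unit operation of colour $i$, and operations can be composed by means of the multiplication of $T$. The classifier for semi-free coproducts $\mathbf T^{T+1}$ is the $I$-indexed family of categories whose objects over $i$ are the operations $b$ with target $i$, together with a colouring of the inputs of $b$ by two colours $X,K$. A morphism $\mathbf b'\to\mathbf b$ is a choice of an operation $b_e$ of $T$ with target $s(e)$ for each $X$-coloured input $e$ of $\mathbf b$, such that $\mathbf b'$ is the operation obtained from $\mathbf b$ by substituting $b_e$ into each $X$-coloured input $e$ (and units into the $K$-coloured inputs), the inputs coming from the $b_e$ being coloured by $X$ and the $K$-coloured inputs being kept. $T$ is called tame if $\mathbf T^{T+1}$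 is a coproduct of categories with terminal object, i.e. if each of its connected components has a terminal object. A $P$-tree is an isomorphism class of finite rooted trees with edges coloured by $I$ and vertices decorated by operations of $T$, the inputs of the decorating operation being identified with the incoming edges of the vertex compatibly with source and target colours; the trees with a single edge and no vertex are included. The Baez–Dolan $+$-construction $T^+$ is the polynomial monad over $B$ generated by $B\leftarrow \mathrm{tree}^*(P)\to\mathrm{tree}(P)\to B$. Here $\mathrm{tree}(P)$ is the set of $P$-trees and $\mathrm{tree}^*(P)$ the set of $P$-trees with a marked vertex; the left map returns the operation decorating the marked vertex, the middle map forgets the marking, and the right map computes the composite operation of the tree in $T$. The unit is given by the trees with exactly one vertex, and the multiplication by substitution of trees into vertices of trees. Theorem. For every polynomial monad $T$, the polynomial monad $T^+$ is tame. More precisely, the objects of $(\mathbf T^+)^{T^++1}$ are $P$-trees with vertices coloured by $X$ and $K$, and every connected component of $(\mathbf T^+)^{T^++1}$ contains exactly one alternating object, and this object is terminal in the component. Here an object is called alternating if it has at least one vertex, adjacent vertices have different colours, and the vertices incident to the root edge or to a leaf are coloured by $X$. -/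

import Mathlib

open CategoryTheory

universe u

namespace BaezDolan

section Polynomials

/-- A polynomial `J ⟵ E ⟶ B ⟶ I` in sets, presented by its fibres: `B i` is the fibre over `i` of
the target map, `E b` is the fibre over `b` of the middle map, and `s` is the source map.  (The
total sets of the diagram are `Σ i, B i` and `Σ i, Σ b : B i, E b`.) -/
structure Poly (J I : Type u) where
  B : I → Type u
  E : ∀ {i : I}, B i → Type u
  s : ∀ {i : I} (b : B i), E b → J

variable {I J : Type u}

/-- The value at `i` of the polynomial functor: the coproduct over `b ∈ B i` of the products
`∏_{e ∈ E b} X (s e)`. -/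
abbrev Poly.Obj (P : Poly J I) (X : J → Type u) (i : I) : Type u :=
  Σ b : P.B i, ∀ e : P.E b, X (P.s b e)

/-- The action of the polynomial functor on maps of families. -/
abbrev Poly.map (P : Poly J I) {X Y : J → Type u} (f : ∀ j, X j → Y j) {i : I}
    (x : P.Obj X i) : P.Obj Y i :=
  ⟨x.1, fun e => f _ (x.2 e)⟩

/-- The polynomial functor `Set/J ⥤ Set/I` generated by a polynomial, where `Set/I` is the category
of `I`-indexed families of sets. -/
def Poly.functor (P : Poly J I) : (J → Type u) ⥤ (I → Type u) where
  obj X := P.Obj X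
  map f := fun _ => ↾(P.map (fun j => f j))

/-- A (finitary) polynomial monad over `I`: a polynomial from `I` to `I` all of whose fibres `E b`
are finite, together with a monad structure on the polynomial functor which it generates whose unit
and multiplication are cartesian natural transformations. -/
structure PolynomialMonad (I : Type u) where
  poly : Poly I I
  finite : ∀ {i : I} (b : poly.B i), Finite (poly.E b)
  η : 𝟭 (I → Type u) ⟶ poly.functor
  μ : poly.functor ⋙ poly.functor ⟶ poly.functor
  assoc : ∀ X, poly.functor.map (μ.app X) ≫ μ.app X = μ.app (poly.functor.obj X) ≫ μ.app X
  left_unit : ∀ X, η.app (poly.functor.obj X) ≫ μ.app X = 𝟙 (poly.functor.obj X)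
  right_unit : ∀ X, poly.functor.map (η.app X) ≫ μ.app X = 𝟙 (poly.functor.obj X)
  η_cartesian : NatTrans.Equifibered η
  μ_cartesian : NatTrans.Equifibered μ

/-- The underlying monad on `Set/I` of a polynomial monad. -/
def PolynomialMonad.toMonad (T : PolynomialMonad I) : Monad (I → Type u) where
  toFunctor := T.poly.functor
  η := T.η
  μ := T.μ
  assoc := T.assoc
  left_unit := T.left_unit
  right_unit := T.right_unit

/-- A square of families of sets is a pullback as soon as it is so elementwise. -/
lemma isPullback_of_existsUnique {A B C D : I → Type u} {f : A ⟶ B} {g : A ⟶ C} {h : B ⟶ D}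
    {k : C ⟶ D} (w : f ≫ h = g ≫ k)
    (H : ∀ i (y : B i) (x : C i), h i y = k i x → ∃! z : A i, f i z = y ∧ g i z = x) :
    IsPullback f g h k := by
  choose l hl hu using H
  have key : ∀ {W : I → Type u} (p : W ⟶ B) (q : W ⟶ C), p ≫ h = q ≫ k →
      ∀ i (v : W i), h i (p i v) = k i (q i v) := fun p q e i v =>
    ConcreteCategory.congr_hom (congrFun e i) v
  refine ⟨⟨w⟩, ⟨Limits.PullbackCone.IsLimit.mk w
    (fun s => fun i => ↾fun v => l i _ _ (key s.fst s.snd s.condition i v)) ?_ ?_ ?_⟩⟩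
  · intro s
    funext i
    ext v
    exact (hl i _ _ (key s.fst s.snd s.condition i v)).1
  · intro s
    funext i
    ext v
    exact (hl i _ _ (key s.fst s.snd s.condition i v)).2
  · intro s m hm1 hm2
    funext i
    ext v
    refine hu i _ _ (key s.fst s.snd s.condition i v) _ ⟨?_, ?_⟩
    · exact ConcreteCategory.congr_hom (congrFun hm1 i) v
    · exact ConcreteCategory.congr_hom (congrFun hm2 i) v

/-- A pullback square of families of sets is a pullback elementwise. -/
lemma existsUnique_of_isPullback {A B C D : I → Type u} {f : A ⟶ B} {g : A ⟶ C} {h : B ⟶ D}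
    {k : C ⟶ D} (H : IsPullback f g h k) {i : I} (y : B i) (x : C i) (e : h i y = k i x) :
    ∃! z : A i, f i z = y ∧ g i z = x := by
  let W : I → Type u := fun j => ULift.{u} (PLift (i = j))
  let pt : ∀ {Z : I → Type u}, Z i → (W ⟶ Z) := fun z j => ↾fun p => p.down.down ▸ z
  have hpt : ∀ {Z Z' : I → Type u} (r : Z ⟶ Z') (z : Z i), pt z ≫ r = pt (r i z) := by
    intro Z Z' r z
    funext j
    ext ⟨⟨p⟩⟩
    subst p
    rfl
  have hw : pt y ≫ h = pt x ≫ k := by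
    rw [hpt h y, hpt k x, e]
  refine ⟨H.lift _ _ hw i ⟨⟨rfl⟩⟩, ⟨?_, ?_⟩, ?_⟩
  · exact ConcreteCategory.congr_hom (congrFun (H.lift_fst _ _ hw) i) ⟨⟨rfl⟩⟩
  · exact ConcreteCategory.congr_hom (congrFun (H.lift_snd _ _ hw) i) ⟨⟨rfl⟩⟩
  · rintro z ⟨hz1, hz2⟩
    have : pt z = H.lift _ _ hw := by
      apply H.hom_ext
      · rw [H.lift_fst, hpt, hz1]
      · rw [H.lift_snd, hpt, hz2]
    rw [← this]
    rfl

end Polynomials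

namespace PolynomialMonad

variable {I : Type u} (T : PolynomialMonad I)

/-- The unit of a polynomial monad, on elements. -/
def unit {X : I → Type u} {i : I} (x : X i) : T.poly.Obj X i := T.η.app X i x

/-- The multiplication of a polynomial monad, on elements. -/
def mul {X : I → Type u} {i : I} (x : T.poly.Obj (T.poly.Obj X) i) : T.poly.Obj X i :=
  T.μ.app X i x

variable {X Y : I → Type u} {i : I}

lemma map_unit (f : ∀ i, X i → Y i) (x : X i) : T.poly.map f (T.unit x) = T.unit (f i x) :=
  (ConcreteCategory.congr_hom (congrFun (T.η.naturality (X := X) (Y := Y) fun i => ↾(f i)) i)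
    x).symm

lemma map_mul (f : ∀ i, X i → Y i) (x : T.poly.Obj (T.poly.Obj X) i) :
    T.poly.map f (T.mul x) = T.mul (T.poly.map (fun _ y => T.poly.map f y) x) :=
  (ConcreteCategory.congr_hom (congrFun (T.μ.naturality (X := X) (Y := Y) fun i => ↾(f i)) i)
    x).symm

lemma mul_map_mul (x : T.poly.Obj (T.poly.Obj (T.poly.Obj X)) i) :
    T.mul (T.poly.map (fun _ y => T.mul y) x) = T.mul (T.mul x) :=
  ConcreteCategory.congr_hom (congrFun (T.assoc X) i) x

lemma mul_unit (x : T.poly.Obj X i) : T.mul (T.unit x) = x :=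
  ConcreteCategory.congr_hom (congrFun (T.left_unit X) i) x

lemma mul_map_unit (x : T.poly.Obj X i) : T.mul (T.poly.map (fun _ y => T.unit y) x) = x :=
  ConcreteCategory.congr_hom (congrFun (T.right_unit X) i) x

lemma unit_cart (f : ∀ i, X i → Y i) (x : T.poly.Obj X i) (y : Y i)
    (h : T.poly.map f x = T.unit y) : ∃! z : X i, f i z = y ∧ T.unit z = x :=
  existsUnique_of_isPullback (T.η_cartesian (i := X) (j := Y) fun i => ↾(f i)) y x h.symm

lemma mul_cart (f : ∀ i, X i → Y i) (x : T.poly.Obj X i) (b : T.poly.B i)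
    (g : ∀ e, T.poly.Obj Y (T.poly.s b e)) (h : T.poly.map f x = T.mul ⟨b, g⟩) :
    ∃! k : ∀ e, T.poly.Obj X (T.poly.s b e),
      (∀ e, T.poly.map f (k e) = g e) ∧ T.mul ⟨b, k⟩ = x := by
  obtain ⟨⟨b', k⟩, ⟨h1, h2⟩, hu⟩ :=
    existsUnique_of_isPullback (T.μ_cartesian (i := X) (j := Y) fun i => ↾(f i)) ⟨b, g⟩ x h.symm
  have h1' : (⟨b', fun e => T.poly.map f (k e)⟩ : T.poly.Obj (T.poly.Obj Y) i) = ⟨b, g⟩ := h1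
  obtain rfl : b' = b := congrArg Sigma.fst h1'
  have h1'' : (fun e => T.poly.map f (k e)) = g := eq_of_heq (Sigma.mk.inj h1').2
  refine ⟨k, ⟨fun e => congrFun h1'' e, h2⟩, ?_⟩
  rintro k' ⟨hk1, hk2⟩
  have : (⟨b', k'⟩ : T.poly.Obj (T.poly.Obj X) i) = ⟨b', k⟩ := by
    refine hu _ ⟨?_, hk2⟩
    exact congrArg (Sigma.mk b') (funext hk1)
  exact eq_of_heq (Sigma.mk.inj this).2

end PolynomialMonad

/-- The two colours: `X` for the operations on an algebra, `K` for the generators of a free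
algebra. -/
inductive Colour : Type u
  | X : Colour
  | K : Colour

namespace PolynomialMonad

variable {I : Type u} (T : PolynomialMonad I)

/-- The unit operation `1_i`. -/
def one (i : I) : T.poly.B i := (T.unit (X := fun _ => PUnit.{u + 1}) (i := i) PUnit.unit).1

/-- The composite operation `b(c_1, …, c_k)`. -/
def comp {i : I} (b : T.poly.B i) (c : ∀ e, T.poly.B (T.poly.s b e)) : T.poly.B i :=
  (T.mul (X := fun _ => PUnit.{u + 1}) ⟨b, fun e => ⟨c e, fun _ => PUnit.unit⟩⟩).1

/-- The objects over `i ∈ I` of the internal classifier `T^{T+1}` for semi-free coproducts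
`X ∨ F_T(K)`: operations `b` of `T` with target `i`, together with a colouring of the inputs of `b`
by the two colours `X` and `K`, i.e. the elements over `i` of `T(1 ⊔ 1)`. -/
structure SemiFree (i : I) : Type u where
  op : T.poly.B i
  col : T.poly.E op → Colour.{u}

/-- The elements over `i` of `T(1 ⊔ 1)`. -/
abbrev TwoObj (i : I) : Type u := T.poly.Obj (fun _ => Colour.{u}) i

/-- A coloured operation as an element of `T(1 ⊔ 1)`. -/
abbrev SemiFree.toObj {T : PolynomialMonad I} {i : I} (x : T.SemiFree i) : T.TwoObj i :=
  ⟨x.op, x.col⟩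

/-- The operations of the monad `T+1` by colour: on the colour `X` those of `T`, on the colour `K`
only identities. -/
def PlusOne : Colour.{u} → I → Type u
  | Colour.X, i => T.poly.B i
  | Colour.K, _ => PUnit

/-- The coloured operation given by an operation of `T+1`: an operation `b` of `T` has all its
inputs coloured by `X`, and the identities of colour `K` have their unique input coloured by `K`. -/
def plusOneToTwo {i : I} : ∀ c : Colour.{u}, T.PlusOne c i → T.TwoObj i
  | Colour.X, b => ⟨b, fun _ => Colour.X⟩
  | Colour.K, _ => T.unit (X := fun _ => Colour.{u}) Colour.K

/-- The coloured operation obtained from `y` by substituting an operation of `T` into each input of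
colour `X`, where all new inputs are coloured by `X` and the inputs of colour `K` stay. -/
def SemiFree.subst {T : PolynomialMonad I} {i : I} (y : T.SemiFree i)
    (d : ∀ e, T.PlusOne (y.col e) (T.poly.s y.op e)) : T.TwoObj i :=
  T.mul (X := fun _ => Colour.{u}) ⟨y.op, fun e => T.plusOneToTwo (y.col e) (d e)⟩

variable {T}

/-- A morphism `x ⟶ y` consists of an operation of `T` for each input of `y` of colour `X` such that
`x` arises from `y` by substituting these operations. -/
@[ext]
structure SemiFree.Hom {i : I} (x y : T.SemiFree i) : Type u where
  ops : ∀ e, T.PlusOne (y.col e) (T.poly.s y.op e)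
  subst_eq : y.subst ops = x.toObj

variable (T)

/-- Pairs of a colour and an operation of `T+1` of that colour. -/
abbrev Coloured (i : I) : Type u := Σ c : Colour.{u}, T.PlusOne c i

/-- The underlying operation of `T` of an operation of `T+1`. -/
def forgetColour {i : I} : T.Coloured i → T.poly.Obj (fun _ => PUnit.{u + 1}) i
  | ⟨Colour.X, b⟩ => ⟨b, fun _ => PUnit.unit⟩
  | ⟨Colour.K, _⟩ => T.unit (X := fun _ => PUnit.{u + 1}) PUnit.unit

/-- The operations of the identity morphisms. -/
def identOp {i : I} : ∀ c : Colour.{u}, T.PlusOne c i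
  | Colour.X => T.one i
  | Colour.K => PUnit.unit

/-- The component of a composite morphism at an input of colour `c`. -/
def compOp {i : I} : ∀ c : Colour.{u}, T.poly.Obj T.Coloured i → T.PlusOne c i
  | Colour.X, w => (T.mul (T.poly.map (fun _ => T.forgetColour) w)).1
  | Colour.K, _ => PUnit.unit

/-- The coloured operation given by an operation of `T+1` of arbitrary colour. -/
abbrev sig {i : I} (d : T.Coloured i) : T.poly.Obj (fun _ => Colour.{u}) i :=
  T.plusOneToTwo d.1 d.2

variable {i : I}

lemma unit_eq {Y : I → Type u} (y : Y i) (y' : Y i) (h : y = y') : T.unit y = T.unit y' := by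
  rw [h]

lemma objOne_ext {x y : T.poly.Obj (fun _ => PUnit.{u + 1}) i} (h : x.1 = y.1) : x = y := by
  obtain ⟨b, f⟩ := x
  obtain ⟨b', f'⟩ := y
  obtain rfl : b = b' := h
  exact congrArg (Sigma.mk b) (funext fun _ => rfl)

lemma sig_identOp (c : Colour.{u}) :
    T.plusOneToTwo c (T.identOp c) = T.unit (X := fun _ => Colour.{u}) (i := i) c := by
  cases c
  · exact T.map_unit (X := fun _ => PUnit.{u + 1}) (Y := fun _ => Colour.{u})
      (fun _ _ => Colour.X) (i := i) PUnit.unit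
  · rfl

lemma eq_unit_of_K (w : T.poly.Obj T.Coloured i) (d : T.PlusOne Colour.K i)
    (h : T.poly.map (fun _ a => a.1) w = T.plusOneToTwo Colour.K d) :
    w = T.unit (X := T.Coloured) ⟨Colour.K, PUnit.unit⟩ := by
  obtain ⟨⟨c, z⟩, ⟨h1, h2⟩, -⟩ :=
    T.unit_cart (X := T.Coloured) (Y := fun _ => Colour.{u}) (fun _ a => a.1) w Colour.K h
  obtain rfl : c = Colour.K := h1
  exact h2.symm

lemma sig_compOp (c : Colour.{u}) (d : T.PlusOne c i) (w : T.poly.Obj T.Coloured i)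
    (h : T.poly.map (fun _ a => a.1) w = T.plusOneToTwo c d) :
    T.plusOneToTwo c (T.compOp c w) =
      T.mul (X := fun _ => Colour.{u}) (T.poly.map (fun _ => T.sig) w) := by
  cases c
  · have h2 : T.poly.map (fun _ => T.sig) w =
        T.poly.map (fun _ v => T.poly.map (Y := fun _ => Colour.{u}) (fun _ _ => Colour.X) v)
          (T.poly.map (fun _ => T.forgetColour) w) := by
      obtain ⟨b, w⟩ := w
      have hb : b = d := congrArg Sigma.fst h
      subst hb
      have hw : (fun e => (w e).1) = fun _ => Colour.X := eq_of_heq (Sigma.mk.inj h).2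
      refine congrArg (Sigma.mk b) (funext fun e => ?_)
      have := congrFun hw e
      dsimp only
      generalize w e = v at this
      obtain ⟨c, v⟩ := v
      obtain rfl : c = Colour.X := this
      rfl
    rw [h2, ← T.map_mul]
    rfl
  · rw [T.eq_unit_of_K w d h, T.map_unit, T.mul_unit]
    rfl

lemma forget_compOp (c : Colour.{u}) (d : T.PlusOne c i) (w : T.poly.Obj T.Coloured i)
    (h : T.poly.map (fun _ a => a.1) w = T.plusOneToTwo c d) :
    T.forgetColour ⟨c, T.compOp c w⟩ = T.mul (T.poly.map (fun _ => T.forgetColour) w) := by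
  cases c
  · rfl
  · rw [T.eq_unit_of_K w d h, T.map_unit, T.mul_unit]
    rfl

lemma exists_lift {x y z : T.SemiFree i} (d : SemiFree.Hom x y) (d' : SemiFree.Hom y z) :
    ∃! w : ∀ e, T.poly.Obj T.Coloured (T.poly.s z.op e),
      (∀ e, T.poly.map (fun _ a => a.1) (w e) = T.plusOneToTwo (z.col e) (d'.ops e)) ∧
      T.mul ⟨z.op, w⟩ = ⟨y.op, fun e => ⟨y.col e, d.ops e⟩⟩ :=
  T.mul_cart (X := T.Coloured) (Y := fun _ => Colour.{u}) (fun _ a => a.1)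
    ⟨y.op, fun e => ⟨y.col e, d.ops e⟩⟩ z.op _ d'.subst_eq.symm

/-- Composition of morphisms: the operations of the second morphism are composed with those
operations of the first one that are substituted into their inputs. -/
noncomputable def SemiFree.Hom.comp {x y z : T.SemiFree i} (d : SemiFree.Hom x y)
    (d' : SemiFree.Hom y z) : SemiFree.Hom x z where
  ops e := T.compOp (z.col e) ((T.exists_lift d d').choose e)
  subst_eq := by
    obtain ⟨h1, h2⟩ := (T.exists_lift d d').choose_spec.1
    have : (fun e => T.plusOneToTwo (z.col e) (T.compOp (z.col e)
        ((T.exists_lift d d').choose e))) = fun e => T.mul (X := fun _ => Colour.{u})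
          (T.poly.map (fun _ => T.sig) ((T.exists_lift d d').choose e)) :=
      funext fun e => T.sig_compOp _ _ _ (h1 e)
    unfold SemiFree.subst
    rw [this]
    refine (T.mul_map_mul (X := fun _ => Colour.{u}) ⟨z.op, fun e =>
      T.poly.map (fun _ => T.sig) ((T.exists_lift d d').choose e)⟩).trans ?_
    refine Eq.trans (congrArg _ (T.map_mul (fun _ => T.sig)
      ⟨z.op, (T.exists_lift d d').choose⟩).symm) ?_
    rw [h2]
    exact d.subst_eq

/-- The identity morphisms. -/
def SemiFree.Hom.id (x : T.SemiFree i) : SemiFree.Hom x x where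
  ops e := T.identOp (x.col e)
  subst_eq := by
    unfold SemiFree.subst
    have : (fun e => T.plusOneToTwo (x.col e) (T.identOp (x.col e))) =
        fun e => T.unit (X := fun _ => Colour.{u}) (i := T.poly.s x.op e) (x.col e) :=
      funext fun e => T.sig_identOp (x.col e)
    rw [this]
    exact T.mul_map_unit x.toObj

lemma comp_ops {x y z : T.SemiFree i} (d : SemiFree.Hom x y) (d' : SemiFree.Hom y z)
    (w : ∀ e, T.poly.Obj T.Coloured (T.poly.s z.op e))
    (h1 : ∀ e, T.poly.map (fun _ a => a.1) (w e) = T.plusOneToTwo (z.col e) (d'.ops e))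
    (h2 : T.mul ⟨z.op, w⟩ = ⟨y.op, fun e => ⟨y.col e, d.ops e⟩⟩) (e) :
    (SemiFree.Hom.comp T d d').ops e = T.compOp (z.col e) (w e) := by
  have := (T.exists_lift d d').choose_spec.2 w ⟨h1, h2⟩
  rw [this]
  rfl

lemma id_comp' {x y : T.SemiFree i} (d : SemiFree.Hom x y) :
    SemiFree.Hom.comp T (SemiFree.Hom.id T x) d = d := by
  apply SemiFree.Hom.ext
  funext e
  rw [T.comp_ops (SemiFree.Hom.id T x) d (fun e => T.poly.map (Y := T.Coloured)
    (fun _ c => ⟨c, T.identOp c⟩) (T.plusOneToTwo (y.col e) (d.ops e))) (fun e => rfl) ?_ e]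
  · generalize d.ops e = b
    generalize y.col e = c at b
    cases c
    · have := T.mul_map_unit (X := fun _ => PUnit.{u + 1}) ⟨b, fun _ => PUnit.unit⟩
      exact congrArg Sigma.fst this
    · rfl
  · have := T.map_mul (X := fun _ => Colour.{u}) (Y := T.Coloured)
      (fun _ c => ⟨c, T.identOp c⟩) ⟨y.op, fun e => T.plusOneToTwo (y.col e) (d.ops e)⟩
    refine this.symm.trans ?_
    exact congrArg (T.poly.map (X := fun _ => Colour.{u}) (Y := T.Coloured)
      (fun _ c => ⟨c, T.identOp c⟩)) d.subst_eq

lemma comp_id' {x y : T.SemiFree i} (d : SemiFree.Hom x y) :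
    SemiFree.Hom.comp T d (SemiFree.Hom.id T y) = d := by
  apply SemiFree.Hom.ext
  funext e
  rw [T.comp_ops d (SemiFree.Hom.id T y) (fun e => T.unit (X := T.Coloured) ⟨y.col e, d.ops e⟩)
    (fun e => ?_) ?_ e]
  · generalize d.ops e = b
    generalize y.col e = c at b
    cases c
    · simp only [compOp]
      rw [T.map_unit, T.mul_unit]
      rfl
    · rfl
  · exact T.mul_map_unit (X := T.Coloured) ⟨y.op, fun e => ⟨y.col e, d.ops e⟩⟩
  · rw [T.map_unit]
    exact (T.sig_identOp (y.col e)).symm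

/-- The data of two composable operations of `T+1`. -/
def Coloured2 (i : I) : Type u :=
  Σ c : Colour.{u}, {p : T.PlusOne c i × T.poly.Obj T.Coloured i //
    T.poly.map (fun _ a => a.1) p.2 = T.plusOneToTwo c p.1}

lemma assoc' {x y z v : T.SemiFree i} (d : SemiFree.Hom x y) (d' : SemiFree.Hom y z)
    (d'' : SemiFree.Hom z v) :
    SemiFree.Hom.comp T (SemiFree.Hom.comp T d d') d'' =
      SemiFree.Hom.comp T d (SemiFree.Hom.comp T d' d'') := by
  obtain ⟨w, ⟨hw1, hw2⟩, -⟩ := T.exists_lift d d'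
  obtain ⟨w', ⟨hw1', hw2'⟩, -⟩ := T.exists_lift d' d''
  obtain ⟨q, ⟨hq1, hq2⟩, -⟩ := T.mul_cart (X := T.Coloured2) (Y := T.Coloured)
    (fun _ a => ⟨a.1, a.2.1.1⟩) ⟨z.op, fun e => ⟨z.col e, ⟨(d'.ops e, w e), hw1 e⟩⟩⟩ v.op w' hw2'.symm
  have hq3 : ∀ e, T.poly.map (Y := fun _ => Colour.{u}) (fun _ a => a.1) (q e) =
      T.plusOneToTwo (v.col e) (d''.ops e) := fun e => by
    rw [← hw1' e, ← hq1 e]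
  apply SemiFree.Hom.ext
  funext e
  rw [T.comp_ops (SemiFree.Hom.comp T d d') d'' (fun e => T.poly.map (Y := T.Coloured)
    (fun _ a => ⟨a.1, T.compOp a.1 a.2.1.2⟩) (q e)) hq3 ?_ e,
    T.comp_ops d (SemiFree.Hom.comp T d' d'') (fun e => T.mul (T.poly.map (Y := T.poly.Obj T.Coloured)
    (fun _ a => a.2.1.2) (q e))) (fun e => ?_) ?_ e]
  · generalize v.col e = c
    cases c
    · simp only [compOp]
      rw [T.map_mul, ← T.mul_map_mul]
      refine congrArg (fun r => (T.mul r).1) ?_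
      refine congrArg (Sigma.mk (q e).1) (funext fun a => ?_)
      exact T.forget_compOp _ _ _ ((q e).2 a).2.2
    · rfl
  · refine (T.mul_map_mul (X := T.Coloured) ⟨v.op, fun e => T.poly.map (Y := T.poly.Obj T.Coloured)
      (fun _ a => a.2.1.2) (q e)⟩).trans ?_
    rw [← hw2]
    congr 1
    refine (T.map_mul (X := T.Coloured2) (Y := T.poly.Obj T.Coloured)
      (fun _ a => a.2.1.2) ⟨v.op, q⟩).symm.trans ?_
    rw [hq2]
  · rw [T.map_mul, T.comp_ops d' d'' w' hw1' hw2' e, T.sig_compOp _ _ _ (hw1' e), ← hq1 e]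
    congr 1
    refine congrArg (Sigma.mk (q e).1) (funext fun a => ?_)
    exact ((q e).2 a).2.2
  · refine (T.map_mul (X := T.Coloured2) (Y := T.Coloured)
      (fun _ a => ⟨a.1, T.compOp a.1 a.2.1.2⟩) ⟨v.op, q⟩).symm.trans ?_
    rw [hq2]
    refine congrArg (Sigma.mk z.op) (funext fun a => ?_)
    exact congrArg (Sigma.mk (z.col a)) (T.comp_ops d d' w hw1 hw2 a).symm

/-- The component over `i` of the internal classifier `T^{T+1}` for semi-free coproducts. -/
noncomputable instance (i : I) : Category.{u} (T.SemiFree i) where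
  Hom x y := SemiFree.Hom x y
  id x := SemiFree.Hom.id T x
  comp d d' := SemiFree.Hom.comp T d d'
  id_comp := T.id_comp'
  comp_id := T.comp_id'
  assoc := T.assoc'

/-- A polynomial monad `T` is tame if the internal classifier `T^{T+1}` for semi-free coproducts is
a coproduct of categories with terminal object: every connected component has a terminal object. -/
def IsTame : Prop :=
  ∀ (i : I) (c : ConnectedComponents (T.SemiFree i)), Limits.HasTerminal c.Component

end PolynomialMonad

section Trees

variable {I : Type u}

/-- The set of `P`-trees with root edge of colour `i` for a polynomial `P` from `I` to `I`: the
tree without vertices whose only edge has colour `i`, and the trees with a root vertex decorated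
by an operation `b` with target `i` and a `P`-tree with root edge of colour `s e` grafted onto each
input `e` of `b`.  (A `P`-tree has no non-trivial automorphisms; so these are the isomorphism
classes of rooted trees with edges coloured by `I` and vertices decorated by operations.) -/
inductive Tree (P : Poly I I) : I → Type u
  | edge (i : I) : Tree P i
  | node {i : I} (b : P.B i) (f : ∀ e : P.E b, Tree P (P.s b e)) : Tree P i

/-- The vertices of a `P`-tree. -/
inductive Tree.Vertex {P : Poly I I} : ∀ {i : I}, Tree P i → Type u
  | root {i : I} {b : P.B i} {f : ∀ e : P.E b, Tree P (P.s b e)} : Vertex (Tree.node b f)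
  | child {i : I} {b : P.B i} {f : ∀ e : P.E b, Tree P (P.s b e)} (e : P.E b)
      (v : Vertex (f e)) : Vertex (Tree.node b f)

/-- The operation decorating a vertex of a `P`-tree, together with its target. -/
def Tree.deco {P : Poly I I} : ∀ {i : I} (τ : Tree P i), τ.Vertex → Σ j, P.B j
  | i, Tree.node b _, Tree.Vertex.root => ⟨i, b⟩
  | _, Tree.node _ f, Tree.Vertex.child e v => (f e).deco v

lemma Tree.finite_vertex {P : Poly I I} (hP : ∀ {i : I} (b : P.B i), Finite (P.E b)) {i : I}
    (τ : Tree P i) : Finite τ.Vertex := by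
  induction τ with
  | edge i => 
    have : IsEmpty (Tree.edge (P := P) i).Vertex := ⟨fun v => nomatch v⟩
    infer_instance
  | node b f ih =>
    have := hP b
    refine Finite.of_surjective (fun o : Option (Σ e, (f e).Vertex) =>
      o.elim Tree.Vertex.root fun p => Tree.Vertex.child p.1 p.2) fun v => ?_
    cases v with
    | root => exact ⟨none, rfl⟩
    | child e v => exact ⟨some ⟨e, v⟩, rfl⟩

/-- The composite operation of a `P`-tree, for the polynomial `P` of a polynomial monad. -/
def PolynomialMonad.composite (T : PolynomialMonad I) : ∀ {i : I}, Tree T.poly i → T.poly.B i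
  | i, Tree.edge _ => T.one i
  | _, Tree.node b f => T.comp b fun e => composite T (f e)

/-- The generating polynomial of the Baez–Dolan `+`-construction of `T`.  Its colours are the
operations of `T`, its operations are the `P`-trees, the target of a `P`-tree is its composite
operation, its inputs are its vertices, and the source of a vertex is the decorating operation. -/
def PolynomialMonad.plusPoly (T : PolynomialMonad I) :
    Poly (Σ i, T.poly.B i) (Σ i, T.poly.B i) where
  B β := {τ : Tree T.poly β.1 // T.composite τ = β.2}
  E τ := τ.1.Vertex
  s τ v := τ.1.deco v

/-- Trees as above whose vertices carry in addition an element of the family `X` over their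
operation and whose leaves carry an element of the family `Y` over their colour. -/
inductive LTree (P : Poly I I) (X : (Σ i, P.B i) → Type u) (Y : I → Type u) : I → Type u
  | leaf {i : I} (y : Y i) : LTree P X Y i
  | node {i : I} (b : P.B i) (x : X ⟨i, b⟩) (f : ∀ e : P.E b, LTree P X Y (P.s b e)) : LTree P X Y i

namespace LTree

variable {P : Poly I I} {X X' X'' : (Σ i, P.B i) → Type u} {Y Y' Y'' : I → Type u} {i : I}

/-- Change of the labels. -/
def map (u : ∀ β, X β → X' β) (g : ∀ i, Y i → Y' i) : ∀ {i : I}, LTree P X Y i → LTree P X' Y' i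
  | _, leaf y => leaf (g _ y)
  | _, node b x f => node b (u _ x) fun e => map u g (f e)

/-- Grafting of trees onto the leaves. -/
def bind : ∀ {i : I}, LTree P X Y i → (∀ i, Y i → LTree P X Y' i) → LTree P X Y' i
  | _, leaf y, k => k _ y
  | _, node b x f, k => node b x fun e => bind (f e) k

lemma map_map (u : ∀ β, X β → X' β) (g : ∀ i, Y i → Y' i) (u' : ∀ β, X' β → X'' β)
    (g' : ∀ i, Y' i → Y'' i) (τ : LTree P X Y i) :
    map u' g' (map u g τ) = map (fun β x => u' β (u β x)) (fun i y => g' i (g i y)) τ := by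
  induction τ with
  | leaf y => rfl
  | node b x f ih => simp only [map, ih]

lemma map_id (τ : LTree P X Y i) : map (fun _ x => x) (fun _ y => y) τ = τ := by
  induction τ with
  | leaf y => rfl
  | node b x f ih => simp only [map, ih]

lemma map_bind (u : ∀ β, X β → X' β) (g : ∀ i, Y' i → Y'' i) (τ : LTree P X Y i)
    (k : ∀ i, Y i → LTree P X Y' i) :
    map u g (τ.bind k) = (map u (fun _ y => y) τ).bind fun i y => map u g (k i y) := by
  induction τ with
  | leaf y => rfl
  | node b x f ih => simp only [map, bind, ih]

lemma bind_map (g : ∀ i, Y i → Y' i) (τ : LTree P X Y i)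
    (k : ∀ i, Y' i → LTree P X Y'' i) :
    (map (fun _ x => x) g τ).bind k = τ.bind fun i y => k i (g i y) := by
  induction τ with
  | leaf y => rfl
  | node b x f ih => simp only [map, bind, ih]

lemma bind_leaf (τ : LTree P X Y i) : τ.bind (fun _ y => leaf y) = τ := by
  induction τ with
  | leaf y => rfl
  | node b x f ih => simp only [bind, ih]

lemma bind_bind (τ : LTree P X Y i) (k : ∀ i, Y i → LTree P X Y' i)
    (k' : ∀ i, Y' i → LTree P X Y'' i) :
    (τ.bind k).bind k' = τ.bind fun i y => (k i y).bind k' := by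
  induction τ with
  | leaf y => rfl
  | node b x f ih => simp only [bind, ih]

/-- Grafting is compatible with pullback along a change of the vertex labels. -/
lemma bind_cart (u : ∀ β, X β → X' β) (z : LTree P X' Y i) (k : ∀ i, Y i → LTree P X' Y' i)
    (σ : LTree P X Y' i) (h : map u (fun _ y => y) σ = z.bind k) :
    ∃! z' : LTree P X (fun i => {p : Y i × LTree P X Y' i // map u (fun _ y => y) p.2 = k i p.1}) i,
      map u (fun _ p => p.1.1) z' = z ∧ z'.bind (fun _ p => p.1.2) = σ := by
  induction z with
  | leaf y =>
    refine ⟨leaf ⟨(y, σ), h⟩, ⟨rfl, rfl⟩, ?_⟩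
    rintro z' ⟨h1, h2⟩
    cases z' with
    | leaf p =>
      have h1' : p.1.1 = y := by simpa [map] using h1
      have h2' : p.1.2 = σ := h2
      subst h1' h2'
      rfl
    | node b x f => simp [map] at h1
  | node b x f ih =>
    cases σ with
    | leaf y => simp [map, bind] at h
    | node b' x' f' =>
      simp only [map, bind, node.injEq] at h
      obtain ⟨rfl, h1, h2⟩ := h
      have h1 := eq_of_heq h1
      have h2 := eq_of_heq h2
      choose t ht hu using fun e => ih e (f' e) (congrFun h2 e)
      refine ⟨node b' x' t, ⟨?_, ?_⟩, ?_⟩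
      · simp only [map, h1, fun e => (ht e).1]
      · simp only [bind, fun e => (ht e).2]
      · rintro z' ⟨h3, h4⟩
        cases z' with
        | leaf p => simp [map] at h3
        | node b x f =>
          simp only [map, node.injEq] at h3
          obtain ⟨rfl, h5, h6⟩ := h3
          simp only [bind, node.injEq, heq_eq_eq, true_and] at h4
          obtain ⟨rfl, h7⟩ := h4
          have h6 := eq_of_heq h6
          congr 1
          funext e
          exact hu e _ ⟨congrFun h6 e, congrFun h7 e⟩

/-- A `P`-tree with labelled vertices as a labelled tree. -/
def ofTree : ∀ {i : I} (τ : Tree P i), (∀ v : τ.Vertex, X (τ.deco v)) →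
    LTree P X (fun _ => PUnit.{u + 1}) i
  | _, Tree.edge _, _ => leaf PUnit.unit
  | _, Tree.node b f, x => node b (x Tree.Vertex.root) fun e =>
      ofTree (f e) fun v => x (Tree.Vertex.child e v)

/-- The family of vertex labels of a tree given by the label of the root vertex and those of the
branches. -/
def nodeLabels {b : P.B i} {f : ∀ e : P.E b, Tree P (P.s b e)} (x : X ⟨i, b⟩)
    (g : ∀ e, ∀ v : (f e).Vertex, X ((f e).deco v)) :
    ∀ v : (Tree.node b f).Vertex, X ((Tree.node b f).deco v)
  | Tree.Vertex.root => x
  | Tree.Vertex.child e v => g e v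

/-- The underlying `P`-tree with its vertex labels. -/
def toTree : ∀ {i : I}, LTree P X (fun _ => PUnit.{u + 1}) i →
    Σ τ : Tree P i, ∀ v : τ.Vertex, X (τ.deco v)
  | i, leaf _ => ⟨Tree.edge i, fun v => nomatch v⟩
  | _, node b x f => ⟨Tree.node b fun e => (toTree (f e)).1,
      nodeLabels x fun e => (toTree (f e)).2⟩

lemma toTree_ofTree (τ : Tree P i) (x : ∀ v : τ.Vertex, X (τ.deco v)) :
    toTree (ofTree τ x) = ⟨τ, x⟩ := by
  induction τ with
  | edge i => exact congrArg (Sigma.mk _) (funext fun v => nomatch v)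
  | node b f ih =>
    have h : (fun e => toTree (ofTree (f e) fun v => x (Tree.Vertex.child e v))) =
        fun e => ⟨f e, fun v => x (Tree.Vertex.child e v)⟩ := funext fun e => ih e _
    have h2 : ∀ g : ∀ e, Σ τ : Tree P (P.s b e), ∀ v : τ.Vertex, X (τ.deco v),
        g = (fun e => ⟨f e, fun v => x (Tree.Vertex.child e v)⟩) →
        (⟨Tree.node b fun e => (g e).1, nodeLabels (x Tree.Vertex.root) fun e => (g e).2⟩ :
          Σ τ : Tree P _, ∀ v : τ.Vertex, X (τ.deco v)) = ⟨Tree.node b f, x⟩ := by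
      rintro g rfl
      refine congrArg (Sigma.mk _) (funext fun v => ?_)
      cases v <;> rfl
    exact h2 _ h

lemma ofTree_toTree (τ : LTree P X (fun _ => PUnit.{u + 1}) i) :
    ofTree (toTree τ).1 (toTree τ).2 = τ := by
  induction τ with
  | leaf y => rfl
  | node b x f ih => exact congrArg (node b x) (funext ih)

lemma map_ofTree (u : ∀ β, X β → X' β) (τ : Tree P i) (x : ∀ v : τ.Vertex, X (τ.deco v)) :
    map u (fun _ y => y) (ofTree τ x) = ofTree τ fun v => u _ (x v) := by
  induction τ with
  | edge i => rfl
  | node b f ih => exact congrArg (node b _) (funext fun e => ih e _)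

end LTree

end Trees

namespace PolynomialMonad

variable {I : Type u} (T : PolynomialMonad I)

/-- The value of a labelled tree under the multiplication of `T`: its composite operation together
with the labels of its leaves. -/
def eval {X : (Σ i, T.poly.B i) → Type u} {Y : I → Type u} :
    ∀ {i : I}, LTree T.poly X Y i → T.poly.Obj Y i
  | _, LTree.leaf y => T.unit y
  | _, LTree.node b _ f => T.mul ⟨b, fun e => eval (f e)⟩

variable {X X' X'' : (Σ i, T.poly.B i) → Type u} {Y Y' Y'' : I → Type u} {i : I}

lemma eval_map (u : ∀ β, X β → X' β) (g : ∀ i, Y i → Y' i) (τ : LTree T.poly X Y i) :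
    T.eval (τ.map u g) = T.poly.map g (T.eval τ) := by
  induction τ with
  | leaf y => exact (T.map_unit g y).symm
  | node b x f ih =>
    simp only [LTree.map, eval, ih]
    exact (T.map_mul g ⟨b, fun e => T.eval (f e)⟩).symm

lemma eval_bind (τ : LTree T.poly X Y i) (k : ∀ i, Y i → LTree T.poly X Y' i) :
    T.eval (τ.bind k) = T.mul (T.poly.map (fun i y => T.eval (k i y)) (T.eval τ)) := by
  induction τ with
  | leaf y =>
    simp only [LTree.bind, eval]
    rw [T.map_unit, T.mul_unit]
  | node b x f ih =>
    simp only [LTree.bind, eval, ih]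
    rw [T.map_mul, ← T.mul_map_mul]

lemma eval_cart (g : ∀ i, Y i → Y' i) (τ' : LTree T.poly X Y' i) (z : T.poly.Obj Y i)
    (h : T.poly.map g z = T.eval τ') :
    ∃! τ : LTree T.poly X Y i, τ.map (fun _ x => x) g = τ' ∧ T.eval τ = z := by
  induction τ' with
  | leaf y' =>
    obtain ⟨y, ⟨h1, h2⟩, hu⟩ := T.unit_cart g z y' h
    refine ⟨LTree.leaf y, ⟨by simp only [LTree.map, h1], h2⟩, ?_⟩
    rintro τ ⟨h3, h4⟩
    cases τ with
    | leaf y2 => rw [hu y2 ⟨by simpa [LTree.map] using h3, h4⟩]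
    | node b x f => simp [LTree.map] at h3
  | node b x f ih =>
    obtain ⟨k, ⟨h1, h2⟩, hu⟩ := T.mul_cart g z b _ h
    choose t ht htu using fun e => ih e (k e) (h1 e)
    refine ⟨LTree.node b x t, ⟨?_, ?_⟩, ?_⟩
    · simp only [LTree.map, fun e => (ht e).1]
    · simp only [eval, fun e => (ht e).2, h2]
    · rintro τ ⟨h3, h4⟩
      cases τ with
      | leaf y2 => simp [LTree.map] at h3
      | node b' x' f' =>
        simp only [LTree.map, LTree.node.injEq] at h3
        obtain ⟨rfl, h5, h6⟩ := h3
        obtain rfl := eq_of_heq h5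
        have h6 := congrFun (eq_of_heq h6)
        have := hu (fun e => T.eval (f' e)) ⟨fun e => by rw [← T.eval_map (fun _ x => x), h6 e], h4⟩
        congr 1
        funext e
        exact htu e _ ⟨h6 e, congrFun this e⟩

lemma eval_ofTree (τ : Tree T.poly i) (x : ∀ v : τ.Vertex, X (τ.deco v)) :
    (T.eval (LTree.ofTree τ x)).1 = T.composite τ := by
  induction τ with
  | edge i => rfl
  | node b f ih =>
    simp only [LTree.ofTree, eval, composite, comp]
    congr 2
    exact congrArg (Sigma.mk b) (funext fun e => T.objOne_ext (ih e _))

/-- The value at `b` of the monad `T^+`: trees with composite operation `b` whose vertices are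
labelled by elements of the family `X` over their operations. -/
def PlusObj (X : (Σ i, T.poly.B i) → Type u) (β : Σ i, T.poly.B i) : Type u :=
  {τ : LTree T.poly X (fun _ => PUnit.{u + 1}) β.1 // (T.eval τ).1 = β.2}

variable {T}

lemma PlusObj.eval_eq {i : I} {b : T.poly.B i} (τ : T.PlusObj X ⟨i, b⟩) :
    T.eval τ.1 = ⟨b, fun _ => PUnit.unit⟩ := T.objOne_ext τ.2

lemma PlusObj.exists_relabel {i : I} {b : T.poly.B i} (τ : T.PlusObj X ⟨i, b⟩)
    (y : ∀ e, Y (T.poly.s b e)) :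
    ∃! σ : LTree T.poly X Y i, σ.map (fun _ x => x) (fun _ _ => PUnit.unit) = τ.1 ∧
      T.eval σ = ⟨b, y⟩ :=
  T.eval_cart (fun _ _ => PUnit.unit) τ.1 ⟨b, y⟩ τ.eval_eq.symm

/-- The leaves of a tree with composite operation `b` are in bijection with the inputs of `b`; this
is the tree whose leaves are labelled by a family indexed by these inputs. -/
noncomputable def PlusObj.relabel {i : I} {b : T.poly.B i} (τ : T.PlusObj X ⟨i, b⟩)
    (y : ∀ e, Y (T.poly.s b e)) : LTree T.poly X Y i := (τ.exists_relabel y).choose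

lemma PlusObj.map_relabel {i : I} {b : T.poly.B i} (τ : T.PlusObj X ⟨i, b⟩)
    (y : ∀ e, Y (T.poly.s b e)) :
    (τ.relabel y).map (fun _ x => x) (fun _ _ => PUnit.unit) = τ.1 :=
  (τ.exists_relabel y).choose_spec.1.1

lemma PlusObj.eval_relabel {i : I} {b : T.poly.B i} (τ : T.PlusObj X ⟨i, b⟩)
    (y : ∀ e, Y (T.poly.s b e)) : T.eval (τ.relabel y) = ⟨b, y⟩ :=
  (τ.exists_relabel y).choose_spec.1.2

lemma PlusObj.relabel_unique {i : I} {b : T.poly.B i} (τ : T.PlusObj X ⟨i, b⟩)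
    (y : ∀ e, Y (T.poly.s b e)) (σ : LTree T.poly X Y i)
    (h1 : σ.map (fun _ x => x) (fun _ _ => PUnit.unit) = τ.1) (h2 : T.eval σ = ⟨b, y⟩) :
    τ.relabel y = σ :=
  ((τ.exists_relabel y).choose_spec.2 σ ⟨h1, h2⟩).symm

lemma PlusObj.map_relabel' {i : I} {b : T.poly.B i} (τ : T.PlusObj X ⟨i, b⟩)
    (y : ∀ e, Y (T.poly.s b e)) (g : ∀ i, Y i → Y' i) :
    (τ.relabel y).map (fun _ x => x) g = τ.relabel fun e => g _ (y e) := by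
  refine (τ.relabel_unique _ _ ?_ ?_).symm
  · rw [LTree.map_map]
    exact τ.map_relabel y
  · rw [T.eval_map, τ.eval_relabel]

/-- Change of the vertex labels. -/
def PlusObj.map (u : ∀ β, X β → X' β) {β : Σ i, T.poly.B i} (τ : T.PlusObj X β) :
    T.PlusObj X' β :=
  ⟨τ.1.map u fun _ y => y, by rw [T.eval_map]; exact τ.2⟩

lemma PlusObj.relabel_map {i : I} {b : T.poly.B i} (u : ∀ β, X β → X' β) (τ : T.PlusObj X ⟨i, b⟩)
    (y : ∀ e, Y (T.poly.s b e)) :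
    (τ.map u).relabel y = (τ.relabel y).map u fun _ y => y := by
  refine PlusObj.relabel_unique _ _ _ ?_ ?_
  · rw [LTree.map_map]
    refine Eq.trans ?_ (congrArg (LTree.map u fun _ y => y) (τ.map_relabel y))
    rw [LTree.map_map]
  · rw [T.eval_map, τ.eval_relabel]

/-- Substitution of trees into the vertices of a tree: a vertex with operation `b` that is labelled
by a tree `τ` with composite operation `b` is replaced by `τ`. -/
noncomputable def flat : ∀ {i : I}, LTree T.poly (T.PlusObj X) Y i → LTree T.poly X Y i
  | _, LTree.leaf y => LTree.leaf y
  | _, LTree.node _ τ f => (PlusObj.relabel τ fun e => flat (f e)).bind fun _ y => y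

lemma eval_flat (τ : LTree T.poly (T.PlusObj X) Y i) : T.eval (flat τ) = T.eval τ := by
  induction τ with
  | leaf y => rfl
  | node b x f ih =>
    simp only [flat, eval]
    rw [eval_bind, PlusObj.eval_relabel]
    exact congrArg (fun k => T.mul ⟨b, k⟩) (funext ih)

lemma flat_map (u : ∀ β, X β → X' β) (g : ∀ i, Y i → Y' i)
    (τ : LTree T.poly (T.PlusObj X) Y i) :
    flat (τ.map (fun _ x => x.map u) g) = (flat τ).map u g := by
  induction τ with
  | leaf y => rfl
  | node b x f ih =>
    simp only [flat, LTree.map, ih]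
    rw [LTree.map_bind, PlusObj.relabel_map, ← PlusObj.map_relabel' x (fun e => flat (f e))
      (fun _ y => y.map u g), LTree.map_map, ← LTree.bind_map (fun _ y => LTree.map u g y)
      _ (fun _ y => y), LTree.map_map]

lemma flat_bind (τ : LTree T.poly (T.PlusObj X) Y i)
    (k : ∀ i, Y i → LTree T.poly (T.PlusObj X) Y' i) :
    flat (τ.bind k) = (flat τ).bind fun i y => flat (k i y) := by
  induction τ with
  | leaf y => rfl
  | node b x f ih =>
    simp only [flat, LTree.bind, ih]
    rw [LTree.bind_bind, ← PlusObj.map_relabel' x (fun e => flat (f e))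
      (fun _ y => y.bind fun i y => flat (k i y)), LTree.bind_map]

/-- The unit of `T^+`: the tree with exactly one vertex. -/
def plusUnit {β : Σ i, T.poly.B i} (x : X β) : T.PlusObj X β :=
  ⟨LTree.node β.2 x fun _ => LTree.leaf PUnit.unit,
    congrArg Sigma.fst (T.mul_map_unit (X := fun _ => PUnit.{u + 1}) ⟨β.2, fun _ => PUnit.unit⟩)⟩

/-- The multiplication of `T^+`: substitution of trees into the vertices of a tree. -/
noncomputable def plusMul {β : Σ i, T.poly.B i} (τ : T.PlusObj (T.PlusObj X) β) : T.PlusObj X β :=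
  ⟨flat τ.1, by rw [eval_flat]; exact τ.2⟩

lemma flat_relabel {i : I} {b : T.poly.B i} (τ : T.PlusObj (T.PlusObj X) ⟨i, b⟩)
    (y : ∀ e, Y (T.poly.s b e)) : flat (τ.relabel y) = (plusMul τ).relabel y := by
  refine (PlusObj.relabel_unique _ _ _ ?_ ?_).symm
  · rw [← flat_map (fun _ x => x)]
    have : (fun (β : Σ i, T.poly.B i) (x : T.PlusObj X β) => PlusObj.map (fun _ x => x) x) =
        fun β x => x := funext fun β => funext fun x => Subtype.ext (LTree.map_id x.1)
    rw [this]
    exact congrArg flat (τ.map_relabel y)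
  · rw [eval_flat, τ.eval_relabel]

lemma relabel_plusUnit {i : I} {b : T.poly.B i} (x : X ⟨i, b⟩) (y : ∀ e, Y (T.poly.s b e)) :
    (plusUnit x).relabel y = LTree.node b x fun e => LTree.leaf (y e) :=
  PlusObj.relabel_unique _ _ _ rfl (T.mul_map_unit ⟨b, y⟩)

lemma flat_map_flat (τ : LTree T.poly (T.PlusObj (T.PlusObj X)) Y i) :
    flat (τ.map (fun _ x => plusMul x) fun _ y => y) = flat (flat τ) := by
  induction τ with
  | leaf y => rfl
  | node b x f ih =>
    simp only [flat, LTree.map, ih]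
    rw [flat_bind, ← PlusObj.map_relabel' (plusMul x) (fun e => flat (f e)) (fun _ y => flat y),
      LTree.bind_map, flat_relabel]

lemma flat_map_unit (τ : LTree T.poly X Y i) :
    flat (τ.map (fun _ x => plusUnit (T := T) x) fun _ y => y) = τ := by
  induction τ with
  | leaf y => rfl
  | node b x f ih =>
    simp only [flat, LTree.map, ih]
    rw [relabel_plusUnit]
    rfl

lemma flat_cart (u : ∀ β, X β → X' β) (ρ : LTree T.poly (T.PlusObj X') Y i)
    (σ : LTree T.poly X Y i) (h : σ.map u (fun _ y => y) = flat ρ) :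
    ∃! ρ' : LTree T.poly (T.PlusObj X) Y i,
      ρ'.map (fun _ x => x.map u) (fun _ y => y) = ρ ∧ flat ρ' = σ := by
  induction ρ with
  | leaf y =>
    cases σ with
    | leaf y' =>
      have h' : y' = y := by simpa [LTree.map, flat] using h
      subst h'
      refine ⟨LTree.leaf y', ⟨rfl, rfl⟩, ?_⟩
      rintro ρ' ⟨h1, h2⟩
      cases ρ' with
      | leaf y'' => simpa [flat] using h2
      | node b x f => simp [LTree.map] at h1
    | node b x f => simp [LTree.map, flat] at h
  | node b ξ f ih =>
    obtain ⟨z', ⟨h1, h2⟩, hu⟩ := LTree.bind_cart u (ξ.relabel fun e => flat (f e))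
      (fun _ y => y) σ h
    have he : T.poly.map (X := fun i => {p : LTree T.poly X' Y i × LTree T.poly X Y i //
        p.2.map u (fun _ y => y) = p.1}) (fun _ p => p.1.1) (T.eval z') = ⟨b, fun e => flat (f e)⟩ := by
      refine (T.eval_map (Y' := fun i => LTree T.poly X' Y i) u _ z').symm.trans ?_
      rw [h1, ξ.eval_relabel]
    obtain ⟨b', r, hr⟩ : ∃ b' r, T.eval z' = ⟨b', r⟩ := ⟨_, _, rfl⟩
    rw [hr] at he
    obtain rfl : b' = b := congrArg Sigma.fst he
    have hr1 : ∀ e, (r e).1.1 = flat (f e) := congrFun (eq_of_heq (Sigma.mk.inj he).2)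
    choose t ht htu using fun e => ih e (r e).1.2 ((r e).2.trans (hr1 e))
    have hξ : ∀ (z : LTree T.poly X (fun i => {p : LTree T.poly X' Y i × LTree T.poly X Y i //
        p.2.map u (fun _ y => y) = p.1}) _),
        z.map u (fun _ p => p.1.1) = ξ.relabel (fun e => flat (f e)) →
        (z.map (fun _ x => x) fun _ _ => PUnit.unit).map u (fun _ y => y) = ξ.1 := by
      intro z hz
      rw [← ξ.map_relabel (fun e => flat (f e)), ← hz, LTree.map_map, LTree.map_map]
    let ξ' : T.PlusObj X ⟨_, b'⟩ :=
      ⟨z'.map (fun _ x => x) fun _ _ => PUnit.unit, by rw [T.eval_map, hr]⟩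
    have hrel : ξ'.relabel (fun e => flat (t e)) = z'.map (fun _ x => x) fun _ p => p.1.2 := by
      refine ξ'.relabel_unique _ _ ?_ ?_
      · rw [LTree.map_map]
      · rw [T.eval_map, hr]
        exact congrArg (Sigma.mk b') (funext fun e => (ht e).2.symm)
    refine ⟨LTree.node b' ξ' t, ⟨?_, ?_⟩, ?_⟩
    · have h3 : ξ'.map u = ξ := Subtype.ext (hξ z' h1)
      simp only [LTree.map, h3, fun e => (ht e).1]
    · simp only [flat]
      rw [hrel, LTree.bind_map]
      exact h2
    · rintro ρ' ⟨h3, h4⟩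
      cases ρ' with
      | leaf y => simp [LTree.map] at h3
      | node b2 ξ2 t2 =>
        simp only [LTree.map, LTree.node.injEq] at h3
        obtain ⟨rfl, h5, h6⟩ := h3
        have h5 : ξ2.map u = ξ := eq_of_heq h5
        have h6 := congrFun (eq_of_heq h6)
        let F : I → Type u := fun i => {p : LTree T.poly X' Y i × LTree T.poly X Y i //
          p.2.map u (fun _ y => y) = p.1}
        let p : ∀ e, {p : LTree T.poly X' Y (T.poly.s b2 e) × LTree T.poly X Y (T.poly.s b2 e) //
            p.2.map u (fun _ y => y) = p.1} := fun e =>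
          ⟨(flat (f e), flat (t2 e)), by rw [← flat_map, h6 e]⟩
        have hz2 := hu (ξ2.relabel (Y := F) p) ⟨?_, ?_⟩
        · have h7 : T.eval z' = ⟨b2, p⟩ := by rw [← hz2, ξ2.eval_relabel]
          rw [hr] at h7
          have h8 : r = p := eq_of_heq (Sigma.mk.inj h7).2
          have h9 : ξ2 = ξ' := by
            refine Subtype.ext ?_
            rw [← ξ2.map_relabel (Y := F) p, hz2]
          rw [h9]
          congr 1
          funext e
          refine htu e _ ⟨h6 e, ?_⟩
          rw [h8]
        · rw [← h5, ξ2.relabel_map, ← ξ2.map_relabel' (Y := F) p (fun _ p => p.1.1), LTree.map_map]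
        · rw [← h4]
          simp only [flat]
          rw [← ξ2.map_relabel' (Y := F) p (fun _ p => p.1.2), LTree.bind_map]

end PolynomialMonad

namespace PolynomialMonad

section Plus

variable {I : Type u} (T : PolynomialMonad I)

variable {T} in
lemma flat_plusUnit {X : (Σ i, T.poly.B i) → Type u} {β : Σ i, T.poly.B i} (τ : T.PlusObj X β) :
    plusMul (plusUnit τ) = τ := by
  obtain ⟨i, b⟩ := β
  refine Subtype.ext ?_
  have h := τ.map_relabel' (Y := fun _ => PUnit.{u + 1})
    (Y' := LTree T.poly X fun _ => PUnit.{u + 1}) (fun _ => PUnit.unit) fun _ y => LTree.leaf y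
  refine (congrArg (fun z => z.bind fun _ y => y) h.symm).trans ?_
  refine (LTree.bind_map _ _ _).trans ((LTree.bind_leaf _).trans ?_)
  exact τ.relabel_unique _ τ.1 (LTree.map_id _) τ.eval_eq

/-- The monad `T^+` in its description by labelled trees. -/
noncomputable def plusTreeMonad : Monad ((Σ i, T.poly.B i) → Type u) where
  obj X := T.PlusObj X
  map u := fun _ => ↾(PlusObj.map fun β => u β)
  map_id X := by
    funext β
    ext τ
    exact Subtype.ext (LTree.map_id τ.1)
  map_comp u v := by
    funext β
    ext τ
    exact Subtype.ext (LTree.map_map (fun β => u β) (fun _ y => y) (fun β => v β)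
      (fun _ y => y) τ.1).symm
  η := { app := fun X β => ↾plusUnit }
  μ :=
    { app := fun X β => ↾plusMul
      naturality := fun X X' u => by
        funext β
        ext τ
        exact Subtype.ext (flat_map (fun β => u β) (fun _ y => y) τ.1) }
  assoc X := by
    funext β
    ext τ
    exact Subtype.ext (flat_map_flat τ.1)
  left_unit X := by
    funext β
    ext τ
    exact flat_plusUnit τ
  right_unit X := by
    funext β
    ext τ
    exact Subtype.ext (flat_map_unit τ.1)

/-- Labelled trees with composite operation `b` are the elements over `b` of the polynomial functor
generated by `P^+`. -/
def plusEquiv (X : (Σ i, T.poly.B i) → Type u) (β : Σ i, T.poly.B i) :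
    T.PlusObj X β ≃ T.plusPoly.Obj X β where
  toFun τ := ⟨⟨(LTree.toTree τ.1).1, by
    rw [← T.eval_ofTree _ (LTree.toTree τ.1).2, LTree.ofTree_toTree]; exact τ.2⟩,
    (LTree.toTree τ.1).2⟩
  invFun x := ⟨LTree.ofTree x.1.1 x.2, (T.eval_ofTree x.1.1 x.2).trans x.1.2⟩
  left_inv τ := Subtype.ext (LTree.ofTree_toTree τ.1)
  right_inv x := by
    obtain ⟨⟨τ, h⟩, x⟩ := x
    have key : ∀ (p : Σ τ : Tree T.poly β.1, ∀ v : τ.Vertex, X (τ.deco v))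
        (hp : T.composite p.1 = β.2), p = ⟨τ, x⟩ →
        (⟨⟨p.1, hp⟩, p.2⟩ : T.plusPoly.Obj X β) = ⟨⟨τ, h⟩, x⟩ := by
      rintro p hp rfl
      rfl
    exact key _ _ (LTree.toTree_ofTree τ x)

lemma plusEquiv_map {X Y : (Σ i, T.poly.B i) → Type u} (u : ∀ β, X β → Y β)
    {β : Σ i, T.poly.B i} (τ : T.PlusObj X β) :
    T.plusEquiv Y β (τ.map u) = T.plusPoly.map u (T.plusEquiv X β τ) := by
  obtain ⟨x, rfl⟩ := (T.plusEquiv X β).symm.surjective τ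
  rw [(T.plusEquiv X β).apply_symm_apply, ← (T.plusEquiv Y β).symm.apply_eq_iff_eq,
    (T.plusEquiv Y β).symm_apply_apply]
  exact Subtype.ext (LTree.map_ofTree u x.1.1 x.2)

/-- The functor underlying `T^+` is generated by `P^+`. -/
noncomputable def plusIso : (T.plusTreeMonad : ((Σ i, T.poly.B i) → Type u) ⥤ _) ≅
    T.plusPoly.functor :=
  NatIso.ofComponents (fun X => Pi.isoMk fun β => (T.plusEquiv X β).toIso) fun {X Y} u => by
    funext β
    ext τ
    exact T.plusEquiv_map (fun β => u β) τ

lemma plusTree_η_cartesian : NatTrans.Equifibered T.plusTreeMonad.η := by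
  intro X X' u
  refine isPullback_of_existsUnique (T.plusTreeMonad.η.naturality u) fun β x' τ h => ?_
  obtain ⟨i, b⟩ := β
  obtain ⟨τ, hτ⟩ := τ
  have h : LTree.node b x' (fun _ => LTree.leaf PUnit.unit) = τ.map (fun β => u β) fun _ y => y :=
    congrArg Subtype.val h
  cases τ with
  | leaf y => simp [LTree.map] at h
  | node b' x f =>
    simp only [LTree.map, LTree.node.injEq] at h
    obtain ⟨rfl, h1, h2⟩ := h
    have h1 := eq_of_heq h1
    have h2 := congrFun (eq_of_heq h2)
    have h3 : f = fun _ => LTree.leaf PUnit.unit := by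
      funext e
      have := h2 e
      generalize f e = t at this
      cases t with
      | leaf y => rfl
      | node b x f => simp [LTree.map] at this
    subst h3
    refine ⟨x, ⟨h1.symm, rfl⟩, ?_⟩
    rintro z ⟨-, hz⟩
    have hz := congrArg Subtype.val hz
    exact eq_of_heq (LTree.node.inj hz).2.1

lemma plusTree_μ_cartesian : NatTrans.Equifibered T.plusTreeMonad.μ := by
  intro X X' u
  refine isPullback_of_existsUnique (T.plusTreeMonad.μ.naturality u) fun β ρ σ h => ?_
  obtain ⟨ρ', ⟨h1, h2⟩, hu⟩ := flat_cart (fun β => u β) ρ.1 σ.1 (congrArg Subtype.val h).symm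
  refine ⟨⟨ρ', ?_⟩, ⟨Subtype.ext h1, Subtype.ext h2⟩, ?_⟩
  · exact (congrArg Sigma.fst ((eval_flat ρ').symm.trans (congrArg T.eval h2))).trans σ.2
  · rintro z ⟨hz1, hz2⟩
    exact Subtype.ext (hu z.1 ⟨congrArg Subtype.val hz1, congrArg Subtype.val hz2⟩)

/-- The Baez–Dolan `+`-construction `T^+` of a polynomial monad `T`: the polynomial monad on the
polynomial `P^+` with multiplication given by substitution of trees into the vertices of trees and
unit given by the trees with exactly one vertex. -/
noncomputable def plus : PolynomialMonad (Σ i, T.poly.B i) where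
  poly := T.plusPoly
  finite τ := τ.1.finite_vertex T.finite
  η := (T.plusTreeMonad.transport T.plusIso).η
  μ := (T.plusTreeMonad.transport T.plusIso).μ
  assoc := (T.plusTreeMonad.transport T.plusIso).assoc
  left_unit := (T.plusTreeMonad.transport T.plusIso).left_unit
  right_unit := (T.plusTreeMonad.transport T.plusIso).right_unit
  η_cartesian := T.plusTree_η_cartesian.comp (.of_isIso T.plusIso.hom)
  μ_cartesian := NatTrans.Equifibered.comp
    (@NatTrans.Equifibered.of_isIso _ _ _ _ _ _ (T.plusIso.inv ◫ T.plusIso.inv)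
      (NatIso.hcomp T.plusIso.symm T.plusIso.symm).isIso_hom)
    (T.plusTree_μ_cartesian.comp (.of_isIso T.plusIso.hom))

end Plus

end PolynomialMonad

/-- `IsAlternating c τ χ`: for the tree `τ` with vertices coloured by `χ`, where the root edge of
`τ` comes out of `τ` into a vertex of colour `c`, the colours of the two ends of each edge are
different; here the missing vertex above a leaf counts as a vertex of colour `K`. -/
def Tree.IsAlternating {I : Type u} {P : Poly I I} : ∀ {i : I} (_ : Colour.{u}) (τ : Tree P i)
    (_ : τ.Vertex → Colour.{u}), Prop
  | _, c, Tree.edge _, _ => c = Colour.X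
  | _, c, Tree.node _ f, χ => χ Tree.Vertex.root ≠ c ∧
      ∀ e, (f e).IsAlternating (χ Tree.Vertex.root) fun v => χ (Tree.Vertex.child e v)

/-- An object of the classifier `(T^+)^{T^+ + 1}`, i.e. a `P`-tree with vertices coloured by `X` and
`K`, is alternating if adjacent vertices have different colours, the vertices at the root and at the
leaves have colour `X`, and the tree is not the tree without vertices. -/
def PolynomialMonad.IsAlternating {I : Type u} (T : PolynomialMonad I) {β : Σ i, T.poly.B i}
    (x : T.plus.SemiFree β) : Prop :=
  Tree.IsAlternating Colour.K x.op.1 x.col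

end BaezDolan

/-!
A morphism `x ⟶ y` of the classifier `(T^+)^{T^+ + 1}` presents the coloured tree `x` as the result
of substituting trees with all vertices of colour `X` into the `X`-vertices of `y`.  So the
morphisms with source `x`, the target being left free, are the elements of the polynomial functor of
`T^+` at the operations of `T^+ + 1` that the multiplication sends to `x`; under the description of
`T^+` by labelled trees these are the trees labelled by operations of `T^+ + 1` whose total
substitution (`subst`) is `x`.

For a given `x` there is exactly one such presentation with alternating `y`.  Cut `x` at the roots
of the `K`-vertices that are reached from its root edge through `X`-vertices only.  The part at the
root is a tree of `X`-vertices, possibly without any vertex (`cut`); contract it to a single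
`X`-vertex decorated by its composite operation (`gather`), and proceed in the same way above the
`K`-vertices.  Contracting a tree without vertices puts a unit operation on
its edge, so that `X`-vertices appear at the root, at the leaves and between any two adjacent
`K`-vertices.  Substituting back returns `x` (`subst_gather_cut`); conversely every alternating
presentation is recovered from its total substitution (`gather_cut_subst`), since a vertex labelled
by a tree `t` with composite `b` together with branches indexed by the inputs of `b` amounts to the
tree `t` with leaves labelled by these branches.

Hence every object has exactly one morphism to exactly one alternating object.  This alternating
object does not change along morphisms, so it depends on the connected component only, and it is
the terminal object of that component (`exists_terminal_of_unique_hom`).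
-/

namespace BaezDolan

/-! ### Reflecting every object of a category into a distinguished terminal object -/

/-- If every object `x` has a morphism to exactly one object satisfying `p`, and only one morphism
to that object, then every connected component has exactly one object satisfying `p`, and this
object is terminal in the component. -/
lemma exists_terminal_of_unique_hom {C : Type*} [Category C] (p : C → Prop)
    (h : ∀ x : C, ∃ y, p y ∧ Nonempty (Unique (x ⟶ y)) ∧
      ∀ y', p y' → Nonempty (x ⟶ y') → y' = y)
    (c : ConnectedComponents C) :
    ∃ x : c.Component, p x.obj ∧ Nonempty (Limits.IsTerminal x) ∧
      ∀ y : c.Component, p y.obj → y = x := by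
  choose N hp hN hu using h
  have hmap : ∀ x : C, Nonempty (x ⟶ N x) := fun x => (hN x).elim fun u => ⟨u.default⟩
  have hhom : ∀ {x y : C}, (x ⟶ y) → N x = N y := fun {x y} f =>
    (hu x _ (hp y) ((hmap y).map fun g => f ≫ g)).symm
  have hzig : ∀ {x y : C}, Zigzag x y → N x = N y := by
    intro x y hxy
    induction hxy with
    | refl => rfl
    | tail _ hz ih =>
      exact ih.trans (hz.elim (fun ⟨f⟩ => hhom f) fun ⟨f⟩ => (hhom f).symm)
  induction c using Quotient.inductionOn with
  | h x₀ =>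
    have hcomp : ∀ y : ConnectedComponents.Component (Quotient.mk (Zigzag.setoid C) x₀),
        N y.obj = N x₀ := fun y => hzig (Quotient.exact y.property)
    refine ⟨⟨N x₀, Quotient.sound ?_⟩, hp x₀, ⟨?_⟩, ?_⟩
    · exact (hmap x₀).elim fun f => Zigzag.of_inv f
    · have huniq : ∀ y : ConnectedComponents.Component (Quotient.mk (Zigzag.setoid C) x₀),
          Nonempty (Unique (y.obj ⟶ N x₀)) := fun y => by
        have := hN y.obj
        rwa [hcomp y] at this
      exact Limits.IsTerminal.ofUniqueHom
        (fun y => ObjectProperty.homMk (huniq y).some.default) fun y m =>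
          ObjectProperty.hom_ext _ ((huniq y).some.uniq m.hom)
    · rintro ⟨y, hy⟩ hpy
      have h1 : y = N y := hu y y hpy ⟨𝟙 y⟩
      have h2 : y = N x₀ := h1.trans (hcomp ⟨y, hy⟩)
      subst h2
      rfl

/-! ### Trees labelled by operations of `T^+ + 1` -/

namespace LTree

variable {I : Type u} {P : Poly I I} {X : (Σ i, P.B i) → Type u} {Y Y' : I → Type u} {i : I}

/-- All leaf labels of the tree satisfy `p`.  This is expressed by a lift to the subtype of labels
satisfying `p`, in which form it passes to the value of the tree in `T` by naturality. -/
def LeavesIn (p : ∀ i, Y i → Prop) (τ : LTree P X Y i) : Prop :=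
  ∃ τ' : LTree P X (fun i => {y : Y i // p i y}) i, τ'.map (fun _ x => x) (fun _ y => y.1) = τ

lemma LeavesIn.leaf {p : ∀ i, Y i → Prop} {y : Y i} (h : p i y) :
    LeavesIn p (LTree.leaf y : LTree P X Y i) :=
  ⟨LTree.leaf ⟨y, h⟩, rfl⟩

lemma LeavesIn.node {p : ∀ i, Y i → Prop} {b : P.B i} {x : X ⟨i, b⟩}
    {f : ∀ e : P.E b, LTree P X Y (P.s b e)} (h : ∀ e, LeavesIn p (f e)) :
    LeavesIn p (LTree.node b x f) := by
  choose g hg using h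
  exact ⟨LTree.node b x g, congrArg (LTree.node b x) (funext hg)⟩

lemma map_bind_eq {X' : (Σ i, P.B i) → Type u} {Z : I → Type u} (u : ∀ β, X β → X' β)
    (g : ∀ i, Y i → Y' i) (τ : LTree P X Y i) (k : ∀ i, Y' i → LTree P X' Z i) :
    (τ.map u g).bind k = (τ.map u fun _ y => y).bind fun i y => k i (g i y) := by
  induction τ with
  | leaf y => rfl
  | node b x f ih => simp only [map, bind, ih]

end LTree

namespace PolynomialMonad

variable {I : Type u} {T : PolynomialMonad I} {Y : I → Type u} {i : I}

lemma eval_leavesIn {X : (Σ i, T.poly.B i) → Type u} {p : ∀ i, Y i → Prop}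
    {τ : LTree T.poly X Y i} (h : τ.LeavesIn p) : ∀ e, p _ ((T.eval τ).2 e) := by
  obtain ⟨τ', rfl⟩ := h
  rw [T.eval_map]
  exact fun e => ((T.eval τ').2 e).2

/-- A `P`-tree without further labels, as an operation of `T^+ + 1` of colour `X`. -/
def plusOneX {β : Σ i, T.poly.B i} (t : T.PlusObj (fun _ => PUnit.{u + 1}) β) :
    T.plus.PlusOne Colour.X β :=
  (T.plusEquiv (fun _ => PUnit.{u + 1}) β t).1

/-- The tree with coloured vertices given by an operation of `T^+ + 1`: a `P`-tree has all vertices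
coloured by `X`, and the identity of colour `K` is the tree with one vertex of colour `K`. -/
noncomputable def colouredTree (β : Σ i, T.poly.B i) (d : T.plus.Coloured β) :
    T.PlusObj (fun _ => Colour.{u}) β :=
  (T.plusEquiv (fun _ => Colour.{u}) β).symm (T.plus.sig d)

/-- `T^+` is transported from the monad of labelled trees along `plusEquiv`, and so is its
multiplication. -/
lemma plus_mul {X : (Σ i, T.poly.B i) → Type u} {β : Σ i, T.poly.B i}
    (v : T.plus.poly.Obj (T.plus.poly.Obj X) β) :
    T.plus.mul v = T.plusEquiv X β (plusMul
      (PlusObj.map (fun β => (T.plusEquiv X β).symm) ((T.plusEquiv _ β).symm v))) := rfl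

lemma colouredTree_K {β : Σ i, T.poly.B i} (d : T.plus.PlusOne Colour.K β) :
    colouredTree β ⟨Colour.K, d⟩ = plusUnit Colour.K :=
  (T.plusEquiv (fun _ => Colour.{u}) β).symm_apply_apply _

lemma colouredTree_X {β : Σ i, T.poly.B i} (t : T.PlusObj (fun _ => PUnit.{u + 1}) β) :
    colouredTree β ⟨Colour.X, plusOneX t⟩ = t.map fun _ _ => Colour.X := by
  refine (Equiv.symm_apply_eq _).2 ?_
  rw [plusEquiv_map]
  rfl

lemma exists_plusOneX_eq {β : Σ i, T.poly.B i} (d : T.plus.PlusOne Colour.X β) :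
    ∃ t, plusOneX t = d :=
  ⟨(T.plusEquiv (fun _ => PUnit.{u + 1}) β).symm ⟨d, fun _ => PUnit.unit⟩,
    congrArg Sigma.fst ((T.plusEquiv (fun _ => PUnit.{u + 1}) β).apply_symm_apply _)⟩

/-- `IsAlt c z`: for the tree `z` with vertices labelled by operations of `T^+ + 1`, grafted onto a
vertex of colour `c`, the colours of the two ends of each edge are different, where the missing
vertex above a leaf counts as a vertex of colour `K`. -/
def IsAlt : ∀ {i : I} (_ : Colour.{u}) (_ : LTree T.poly T.plus.Coloured Y i), Prop
  | _, c, LTree.leaf _ => c = Colour.X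
  | _, c, LTree.node _ d f => d.1 ≠ c ∧ ∀ e, IsAlt d.1 (f e)

lemma isAlt_ofTree (τ : Tree T.poly i) (x : ∀ v : τ.Vertex, T.plus.Coloured (τ.deco v))
    (c : Colour.{u}) :
    IsAlt c (LTree.ofTree τ x) ↔ τ.IsAlternating c fun v => (x v).1 := by
  induction τ generalizing c with
  | edge i => rfl
  | node b f ih => exact and_congr Iff.rfl (forall_congr' fun e => ih e _ _)

/-! ### Existence and uniqueness of the alternating presentation -/

/-- The total substitution of a tree labelled by operations of `T^+ + 1`. -/
noncomputable def subst (z : LTree T.poly T.plus.Coloured Y i) :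
    LTree T.poly (fun _ => Colour.{u}) Y i :=
  flat (z.map colouredTree fun _ y => y)

/-- A tree, with its leaf labels dropped, as an element of `T^+` over its composite operation. -/
def shape {X : (Σ i, T.poly.B i) → Type u} (σ : LTree T.poly X Y i) :
    T.PlusObj X ⟨i, (T.eval σ).1⟩ :=
  ⟨σ.map (fun _ x => x) fun _ _ => PUnit.unit, by rw [T.eval_map]⟩

lemma relabel_shape {X : (Σ i, T.poly.B i) → Type u} (σ : LTree T.poly X Y i) :
    (shape σ).relabel (T.eval σ).2 = σ :=
  PlusObj.relabel_unique _ _ σ rfl rfl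

/-- Contraction of a tree of `X`-vertices to a single `X`-vertex, decorated by the composite
operation and labelled by the tree itself; the leaf labels are grafted onto this vertex. -/
noncomputable def gather
    (σ : LTree T.poly (fun _ => PUnit.{u + 1}) (LTree T.poly T.plus.Coloured Y) i) :
    LTree T.poly T.plus.Coloured Y i :=
  LTree.node (T.eval σ).1 ⟨Colour.X, plusOneX (shape σ)⟩ (T.eval σ).2

/-- The maximal tree of `X`-vertices at the root of a coloured tree.  Its leaves are the leaves and
the lowest `K`-vertices of the given tree.  It is labelled at such a leaf by the alternating
presentation of the part of the tree above: a leaf, or a `K`-vertex with the contracted branches. -/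
noncomputable def cut : ∀ {i : I}, LTree T.poly (fun _ => Colour.{u}) Y i →
    LTree T.poly (fun _ => PUnit.{u + 1}) (LTree T.poly T.plus.Coloured Y) i
  | _, LTree.leaf y => LTree.leaf (LTree.leaf y)
  | _, LTree.node b Colour.X f => LTree.node b PUnit.unit fun e => cut (f e)
  | _, LTree.node b Colour.K f =>
      LTree.leaf (LTree.node b ⟨Colour.K, PUnit.unit⟩ fun e => gather (cut (f e)))

lemma eval_subst (z : LTree T.poly T.plus.Coloured Y i) : T.eval (subst z) = T.eval z := by
  rw [subst, eval_flat, T.eval_map]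

lemma subst_node_X {b : T.poly.B i} (t : T.PlusObj (fun _ => PUnit.{u + 1}) ⟨i, b⟩)
    (f : ∀ e, LTree T.poly T.plus.Coloured Y (T.poly.s b e)) :
    subst (LTree.node b ⟨Colour.X, plusOneX t⟩ f) =
      ((t.relabel f).map (fun _ _ => Colour.X) fun _ y => y).bind fun _ z => subst z := by
  simp only [subst, LTree.map, flat]
  rw [colouredTree_X, PlusObj.relabel_map,
    ← t.map_relabel' f fun _ z => flat (z.map colouredTree fun _ y => y),
    LTree.map_map, LTree.map_bind_eq]

lemma subst_node_K {b : T.poly.B i} (d : T.plus.PlusOne Colour.K ⟨i, b⟩)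
    (f : ∀ e, LTree T.poly T.plus.Coloured Y (T.poly.s b e)) :
    subst (LTree.node b ⟨Colour.K, d⟩ f) =
      LTree.node (X := fun _ => Colour.{u}) b Colour.K fun e => subst (f e) := by
  simp only [subst, LTree.map, flat]
  rw [colouredTree_K, relabel_plusUnit]
  rfl

/-- A vertex labelled by a tree together with its branches is the contraction of this tree with the
branches as leaf labels. -/
lemma gather_relabel {b : T.poly.B i} (t : T.PlusObj (fun _ => PUnit.{u + 1}) ⟨i, b⟩)
    (f : ∀ e, LTree T.poly T.plus.Coloured Y (T.poly.s b e)) :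
    gather (t.relabel f) = LTree.node b ⟨Colour.X, plusOneX t⟩ f := by
  have key : ∀ (o : T.poly.Obj (LTree T.poly T.plus.Coloured Y) i)
      (s : LTree T.poly (fun _ => PUnit.{u + 1}) (fun _ => PUnit.{u + 1}) i)
      (hs : (T.eval s).1 = o.1), o = ⟨b, f⟩ → s = t.1 →
      LTree.node (X := T.plus.Coloured) o.1 ⟨Colour.X, plusOneX ⟨s, hs⟩⟩ o.2 =
        LTree.node b ⟨Colour.X, plusOneX t⟩ f := by
    rintro _ _ _ rfl rfl
    rfl
  exact key _ _ _ (t.eval_relabel f) (t.map_relabel f)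

lemma subst_gather
    (σ : LTree T.poly (fun _ => PUnit.{u + 1}) (LTree T.poly T.plus.Coloured Y) i) :
    subst (gather σ) = (σ.map (fun _ _ => Colour.X) fun _ y => y).bind fun _ z => subst z := by
  refine (subst_node_X _ _).trans ?_
  rw [relabel_shape]

lemma subst_cut (x : LTree T.poly (fun _ => Colour.{u}) Y i) :
    ((cut x).map (fun _ _ => Colour.X) fun _ y => y).bind (fun _ z => subst z) = x := by
  induction x with
  | leaf y => rfl
  | node b c f ih =>
    cases c with
    | X => exact congrArg (LTree.node b _) (funext ih)
    | K =>
      refine (subst_node_K _ _).trans (congrArg (LTree.node b _) (funext fun e => ?_))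
      rw [subst_gather, ih]

lemma subst_gather_cut (x : LTree T.poly (fun _ => Colour.{u}) Y i) :
    subst (gather (cut x)) = x :=
  (subst_gather _).trans (subst_cut x)

lemma isAlt_gather
    {σ : LTree T.poly (fun _ => PUnit.{u + 1}) (LTree T.poly T.plus.Coloured Y) i}
    (h : σ.LeavesIn fun _ z => IsAlt Colour.X z) : IsAlt Colour.K (gather σ) :=
  ⟨fun h => Colour.noConfusion h, eval_leavesIn h⟩

lemma cut_leavesIn (x : LTree T.poly (fun _ => Colour.{u}) Y i) :
    (cut x).LeavesIn fun _ z => IsAlt Colour.X z := by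
  induction x with
  | leaf y => exact .leaf rfl
  | node b c f ih =>
    cases c with
    | X => exact .node ih
    | K => exact .leaf ⟨fun h => Colour.noConfusion h, fun e => isAlt_gather (ih e)⟩

lemma cut_bind {Y' : I → Type u} (σ : LTree T.poly (fun _ => PUnit.{u + 1}) Y' i)
    (k : ∀ i, Y' i → LTree T.poly (fun _ => Colour.{u}) Y i) :
    cut ((σ.map (fun _ _ => Colour.X) fun _ y => y).bind k) = σ.bind fun i y => cut (k i y) := by
  induction σ with
  | leaf y => rfl
  | node b x f ih => exact congrArg (LTree.node b _) (funext ih)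

/-- A tree alternating at the root is recovered from its total substitution by contraction.  If
instead the tree is alternating when grafted onto an `X`-vertex, then it is a leaf or has a root
vertex of colour `K`, and the `X`-tree at the root of its total substitution has no vertices. -/
lemma cut_subst (z : LTree T.poly T.plus.Coloured Y i) :
    (IsAlt Colour.K z → gather (cut (subst z)) = z) ∧
      (IsAlt Colour.X z → cut (subst z) = LTree.leaf z) := by
  induction z with
  | leaf y => exact ⟨fun h => Colour.noConfusion h, fun _ => rfl⟩
  | node b d f ih =>
    obtain ⟨c, d⟩ := d
    cases c with
    | X =>
      refine ⟨fun h => ?_, fun h => absurd rfl h.1⟩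
      obtain ⟨t, rfl⟩ := exists_plusOneX_eq d
      rw [subst_node_X, cut_bind, ← gather_relabel]
      -- The induction hypothesis is available on the branches only, so the leaf labels of
      -- `t.relabel f` are rewritten through the uniqueness of the relabelling.
      have h1 : (t.relabel f).map (fun _ x => x) (fun _ z => cut (subst z)) =
          (t.relabel f).map (fun _ x => x) fun _ z => LTree.leaf z := by
        rw [t.map_relabel', t.map_relabel' f fun _ z => LTree.leaf z]
        exact congrArg t.relabel (funext fun e => (ih e).2 (h.2 e))
      have h2 := congrArg (fun τ => τ.bind fun _ z => z) h1
      simp only [LTree.bind_map, LTree.bind_leaf] at h2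
      rw [h2]
    | K =>
      refine ⟨fun h => absurd rfl h.1, fun h => ?_⟩
      rw [subst_node_K]
      exact congrArg LTree.leaf (congrArg (LTree.node b _) (funext fun e => (ih e).1 (h.2 e)))

lemma gather_cut_subst {z : LTree T.poly T.plus.Coloured Y i} (h : IsAlt Colour.K z) :
    gather (cut (subst z)) = z :=
  (cut_subst z).1 h

/-! ### Alternating objects of the classifier -/

/-- Substitution in the sense of the classifier is total substitution of labelled trees. -/
lemma plus_mul_sig {β : Σ i, T.poly.B i} (w : T.plus.poly.Obj T.plus.Coloured β) :
    (T.plusEquiv (fun _ => Colour.{u}) β).symm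
        (T.plus.mul (T.plus.poly.map (fun _ => T.plus.sig) w)) =
      plusMul (((T.plusEquiv _ β).symm w).map colouredTree) := by
  rw [plus_mul, Equiv.symm_apply_apply]
  refine congrArg plusMul (Subtype.ext ?_)
  obtain ⟨z, rfl⟩ := (T.plusEquiv T.plus.Coloured β).surjective w
  have h : (T.plusEquiv _ β).symm (T.plusPoly.map (fun _ => T.plus.sig) (T.plusEquiv _ β z)) =
      z.map fun _ => T.plus.sig := (Equiv.symm_apply_eq _).2 (T.plusEquiv_map _ z).symm
  rw [Equiv.symm_apply_apply]
  exact (congrArg (fun τ => LTree.map _ _ τ.1) h).trans (LTree.map_map _ _ _ _ z.1)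

/-- An element `w` encodes a morphism with source `x` together with its target: the target is given
by the operation of `w` and the colours of its labels, the morphism by the operations in its
labels. -/
lemma existsUnique_alternating_lift {β : Σ i, T.poly.B i} (x : T.plus.SemiFree β) :
    ∃! w : T.plus.poly.Obj T.plus.Coloured β,
      Tree.IsAlternating Colour.K w.1.1 (fun v => (w.2 v).1) ∧
        T.plus.mul (T.plus.poly.map (fun _ => T.plus.sig) w) = x.toObj := by
  let tree := (T.plusEquiv T.plus.Coloured β).symm
  let t := LTree.ofTree (X := fun _ => Colour.{u}) x.op.1 x.col
  have hsubst : ∀ w : T.plus.poly.Obj T.plus.Coloured β,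
      T.plus.mul (T.plus.poly.map (fun _ => T.plus.sig) w) = x.toObj ↔ subst (tree w).1 = t := by
    intro w
    refine ((T.plusEquiv (fun _ => Colour.{u}) β).symm.apply_eq_iff_eq).symm.trans ?_
    exact (Eq.congr_left (plus_mul_sig w)).trans Subtype.ext_iff
  have halt : ∀ w : T.plus.poly.Obj T.plus.Coloured β,
      Tree.IsAlternating Colour.K w.1.1 (fun v => (w.2 v).1) ↔ IsAlt Colour.K (tree w).1 :=
    fun w => (isAlt_ofTree _ _ _).symm
  simp only [hsubst, halt]
  refine (tree.bijective.existsUnique_iff (p := fun z : T.PlusObj T.plus.Coloured β =>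
    IsAlt Colour.K z.1 ∧ subst z.1 = t)).1 ⟨⟨gather (cut t), ?_⟩, ⟨?_, subst_gather_cut t⟩, ?_⟩
  · rw [← eval_subst, subst_gather_cut]
    exact (T.eval_ofTree (X := fun _ => Colour.{u}) x.op.1 x.col).trans x.op.2
  · exact isAlt_gather (cut_leavesIn t)
  · rintro z ⟨hz1, hz2⟩
    refine Subtype.ext ?_
    rw [← gather_cut_subst hz1, hz2]

lemma exists_alternating_unique_hom {β : Σ i, T.poly.B i} (x : T.plus.SemiFree β) :
    ∃ y, T.IsAlternating y ∧ Nonempty (Unique (x ⟶ y)) ∧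
      ∀ y', T.IsAlternating y' → Nonempty (x ⟶ y') → y' = y := by
  obtain ⟨w, ⟨hw1, hw2⟩, hu⟩ := existsUnique_alternating_lift x
  have key : ∀ (y : T.plus.SemiFree β) (d : SemiFree.Hom x y), T.IsAlternating y →
      (⟨y.op, fun v => ⟨y.col v, d.ops v⟩⟩ : T.plus.poly.Obj T.plus.Coloured β) = w :=
    fun y d hy => hu _ ⟨hy, d.subst_eq⟩
  refine ⟨⟨w.1, fun v => (w.2 v).1⟩, hw1, ⟨⟨⟨⟨fun v => (w.2 v).2, hw2⟩⟩, fun d => ?_⟩⟩, ?_⟩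
  · have h := eq_of_heq (Sigma.mk.inj (key _ d hw1)).2
    exact SemiFree.Hom.ext (funext fun v => eq_of_heq (Sigma.mk.inj (congrFun h v)).2)
  · rintro y' hy' ⟨d⟩
    obtain rfl := key y' d hy'
    rfl

end PolynomialMonad

end BaezDolan

theorem mainTheorem8 {I : Type u} (T : BaezDolan.PolynomialMonad I) :
    T.plus.IsTame ∧
    ∀ (β : Σ i, T.poly.B i) (c : ConnectedComponents (T.plus.SemiFree β)),
      ∃ x : c.Component, T.IsAlternating x.obj ∧ Nonempty (Limits.IsTerminal x) ∧
        ∀ y : c.Component, T.IsAlternating y.obj → y = x := by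
  have h := fun β => BaezDolan.exists_terminal_of_unique_hom
    (fun x : T.plus.SemiFree β => T.IsAlternating x)
    BaezDolan.PolynomialMonad.exists_alternating_unique_hom
  refine ⟨fun β c => ?_, h⟩
  obtain ⟨x, -, ⟨hx⟩, -⟩ := h β c
  exact hx.hasTerminal
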